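/- Let $\tau$ be the difference expression acting on complex sequences $u=(u_n)_{n\ge 0}$ by $$(\tau u)_0=u_0+u_1,\qquad (\tau u)_n=n\,u_{n-1}+(2n+1)\,u_n+(n+1)\,u_{n+1}\quad(n\ge 1),$$ and let $H_0$ be the discrete Laguerre operator in $\ell^2(\mathbb N_0)$, that is, $H_0u=\tau u$ on the maximal domain $\{u\in\ell^2(\mathbb N_0):\tau u\in\ell^2(\mathbb N_0)\}$. Then there is exactly one strongly continuous one-parameter group of unitary operators $U(t)=\mathrm e^{-\mathrm i tH_0}$, $t\in\mathbb R$, on $\ell^2(\mathbb N_0)$ generated by $H_0$, in the sense that $\lim_{t\to 0}\frac{\mathrm i}{t}\,(U(t)u-u)$ exists in $\ell^2(\mathbb N_0)$ if and only if $u$ lies in the domain of $H_0$, and then equals $H_0u$. For every $t\in\mathbb R$, the norm of $\mathrm e^{-\mathrm i tH_0}$ as an operator from $\ell^1(\mathbb N_0)\subset\ell^2(\mathbb N_0)$ to $\ell^\infty(\mathbb N_0)\supset\ell^2(\mathbb N_0)$ is $$\big\|\mathrm e^{-\mathrm i tH_0}\big\|_{\ell^1\to\ell^\infty}=\frac{1}{\sqrt{1+t^2}}.$$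 -/

import Mathlib

open scoped ENNReal

/-- The space `ℓ^p(ℕ₀)` of complex sequences, with its usual norm. -/
abbrev SeqLp (p : ℝ≥0∞) : Type := lp (fun _ : ℕ => ℂ) p

/-- The Laguerre difference expression `τ`, acting on arbitrary complex sequences. -/
def laguerreTau : (ℕ → ℂ) →ₗ[ℂ] (ℕ → ℂ) where
  toFun u n :=
    match n with
    | 0 => u 0 + u 1
    | k + 1 => ((k : ℂ) + 1) * u k + (2 * ((k : ℂ) + 1) + 1) * u (k + 1)
        + ((k : ℂ) + 2) * u (k + 2)
  map_add' u v := by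
    funext n
    cases n <;> simp only [Pi.add_apply] <;> ring
  map_smul' c u := by
    funext n
    cases n <;> simp only [Pi.smul_apply, smul_eq_mul, RingHom.id_apply] <;> ring

/-- The discrete Laguerre operator `H₀` in `ℓ²(ℕ₀)`: it acts by `τ` on its maximal domain
`{u ∈ ℓ² : τ u ∈ ℓ²}`. -/
def laguerreOperator : SeqLp 2 →ₗ.[ℂ] SeqLp 2 where
  domain :=
    { carrier := {u | Memℓp (laguerreTau (u : ℕ → ℂ)) 2}
      add_mem' := fun {u v} hu hv => by
        have h : Memℓp (laguerreTau (u : ℕ → ℂ) + laguerreTau (v : ℕ → ℂ)) 2 :=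
          Memℓp.add hu hv
        rw [← map_add] at h
        exact h
      zero_mem' := by
        have h : Memℓp (0 : ℕ → ℂ) 2 := zero_memℓp
        rw [← map_zero laguerreTau] at h
        exact h
      smul_mem' := fun c u hu => by
        have h : Memℓp (c • laguerreTau (u : ℕ → ℂ)) 2 := Memℓp.const_smul hu c
        rw [← map_smul] at h
        exact h }
  toFun :=
    { toFun := fun u => ⟨laguerreTau ((u : SeqLp 2) : ℕ → ℂ), u.2⟩
      map_add' := fun u v => Subtype.ext (laguerreTau.map_add _ _)
      map_smul' := fun c u => Subtype.ext (laguerreTau.map_smul c _) }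

/-- `U` is the evolution group `t ↦ exp(-itA)` of the (unbounded) operator `A` in the sense of
Stone's theorem: a strongly continuous one-parameter group of unitary operators whose
infinitesimal generator is `-iA`. The last field says that the limit
`lim_{t → 0} i (U(t) u - u) / t` exists precisely for `u` in the domain of `A`, and that it is
then equal to `A u`. -/
structure IsEvolutionGroup {E : Type*} [NormedAddCommGroup E] [InnerProductSpace ℂ E]
    [CompleteSpace E] (A : E →ₗ.[ℂ] E) (U : ℝ → E →L[ℂ] E) : Prop where
  unitary : ∀ t, U t ∈ unitary (E →L[ℂ] E)
  map_zero : U 0 = 1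
  map_add : ∀ s t, U (s + t) = U s * U t
  continuous : ∀ u, Continuous fun t => U t u
  generator : ∀ u f : E,
    Filter.Tendsto (fun t : ℝ => (Complex.I / (t : ℂ)) • (U t u - u)) (nhdsWithin 0 {0}ᶜ) (nhds f)
      ↔ ∃ hu : u ∈ A.domain, A ⟨u, hu⟩ = f

/-- The inclusion `ℓ¹ ⊆ ℓ²` as a bounded operator. -/
noncomputable def inclOneTwo : SeqLp 1 →L[ℂ] SeqLp 2 :=
  (lp.linearMapOfLE ℂ (fun _ : ℕ => ℂ) (p := 1) (q := 2) one_le_two).mkContinuous 1 (by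
    intro u
    rw [one_mul]
    refine lp.norm_le_of_forall_sum_le (by norm_num) (norm_nonneg u) fun s => ?_
    have h1 : ∑ i ∈ s, ‖u i‖ ≤ ‖u‖ := by
      simpa using lp.sum_rpow_le_norm_rpow (p := 1) (by norm_num) u s
    have h2 : ∀ i, ‖u i‖ ≤ ‖u‖ := lp.norm_apply_le_norm one_ne_zero u
    simp only [lp.coe_linearMapOfLE_apply, ENNReal.toReal_ofNat, Real.rpow_two]
    calc ∑ i ∈ s, ‖u i‖ ^ 2 ≤ ∑ i ∈ s, ‖u‖ * ‖u i‖ :=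
          Finset.sum_le_sum fun i _ => by nlinarith [h2 i, norm_nonneg (u i)]
      _ = ‖u‖ * ∑ i ∈ s, ‖u i‖ := (Finset.mul_sum _ _ _).symm
      _ ≤ ‖u‖ ^ 2 := by nlinarith [norm_nonneg u])

/-- The inclusion `ℓ² ⊆ ℓ^∞` as a bounded operator. -/
noncomputable def inclTwoInfty : SeqLp 2 →L[ℂ] SeqLp ∞ :=
  (lp.linearMapOfLE ℂ (fun _ : ℕ => ℂ) (p := 2) (q := ∞) le_top).mkContinuous 1 (by
    intro u
    rw [one_mul]
    exact lp.norm_le_of_forall_le (norm_nonneg u)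
      (fun n => lp.norm_apply_le_norm two_ne_zero u n))

/-- A bounded operator on `ℓ²`, regarded as an operator from `ℓ¹` to `ℓ^∞`. Its norm in
`SeqLp 1 →L[ℂ] SeqLp ∞` is the operator norm `ℓ¹ → ℓ^∞`. -/
noncomputable def asOneInfty (B : SeqLp 2 →L[ℂ] SeqLp 2) : SeqLp 1 →L[ℂ] SeqLp ∞ :=
  inclTwoInfty.comp (B.comp inclOneTwo)

/-!
In the basis of the sequences `n ↦ C(n, j) (b - 1) ^ (n - j)` with `b = 1 / (1 + it)`, the kernel of
`exp(-itH₀)` is diagonal with entries `b ^ (2 j + 1)`; this makes it a polynomial `K b n m` in `b`,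
symmetric in `n` and `m`, with `τ` acting in the same way on either variable and
`dK / db = τ K / b ^ 2`. A kernel with this symmetry is determined by its zeroth column, so the
group law `K_s K_t = K_{s + t}` reduces to summing a generating function. Together with
`conj (K_t) = K_{-t}` it shows that the rows of `K_t` are orthonormal, which yields the unitary
group.

For the norm, `K b n m` is `b` times a diagonal matrix coefficient of the symmetric power
`Sym ^ (n + m)` of the matrix `[[b - 1, b], [b, b - 1]]`, which is unitary since `|b| ^ 2 = Re b`.
Hence `|K b n m| ≤ |b| = 1 / √(1 + t ^ 2)`, with equality at `n = m = 0`.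
-/

open Filter Topology Finset

/-! ### Symmetry of the difference expression -/

theorem laguerreTau_apply (u : ℕ → ℂ) (n : ℕ) :
    laguerreTau u n = n * u (n - 1) + (2 * n + 1) * u n + (n + 1) * u (n + 1) := by
  cases n with
  | zero => simp [laguerreTau]
  | succ k =>
    simp only [laguerreTau, LinearMap.coe_mk, AddHom.coe_mk, Nat.add_sub_cancel]
    push_cast
    ring

theorem norm_laguerreTau_apply_le (u : ℕ → ℂ) (n : ℕ) :
    ‖laguerreTau u n‖ ≤ n * ‖u (n - 1)‖ + (2 * n + 1) * ‖u n‖ + (n + 1) * ‖u (n + 1)‖ := by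
  have norm_coeff : ‖2 * (n : ℂ) + 1‖ = 2 * n + 1 ∧ ‖(n : ℂ) + 1‖ = n + 1 :=
    ⟨mod_cast Complex.norm_natCast (2 * n + 1), mod_cast Complex.norm_natCast (n + 1)⟩
  rw [laguerreTau_apply]
  refine (norm_add₃_le ..).trans_eq ?_
  simp only [norm_mul, norm_coeff, Complex.norm_natCast]

theorem norm_laguerreTau_apply_le_of_forall_norm_le {w : ℕ → ℂ} {C : ℝ} (hw : ∀ k, ‖w k‖ ≤ C)
    (n : ℕ) : ‖laguerreTau w n‖ ≤ 4 * C * (n + 1) := by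
  nlinarith [n.cast_nonneg (α := ℝ), norm_laguerreTau_apply_le w n, hw (n - 1), hw n, hw (n + 1),
    norm_nonneg (w n)]

theorem summable_norm_laguerreTau {v : ℕ → ℂ} (hv : Summable fun k : ℕ => (k + 1) * ‖v k‖) :
    Summable fun k => ‖laguerreTau v k‖ := by
  have hprev : Summable fun k : ℕ => k * ‖v (k - 1)‖ := by
    rw [← summable_nat_add_iff 1]
    simpa using hv
  have hnext : Summable fun k : ℕ => ((k + 1 : ℕ) + 1) * ‖v (k + 1)‖ :=
    (summable_nat_add_iff 1).2 hv
  refine .of_nonneg_of_le (fun _ => norm_nonneg _) (fun k => ?_)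
    ((hprev.add (hv.mul_left 2)).add hnext)
  push_cast
  linarith [norm_laguerreTau_apply_le v k, norm_nonneg (v k), norm_nonneg (v (k + 1))]

theorem sum_range_laguerreTau_mul_sub (v w : ℕ → ℂ) (N : ℕ) :
    ∑ k ∈ range N, (laguerreTau v k * w k - v k * laguerreTau w k) =
      N * (v N * w (N - 1) - v (N - 1) * w N) := by
  induction N with
  | zero => simp
  | succ N ih =>
    rw [sum_range_succ, ih, laguerreTau_apply, laguerreTau_apply, Nat.add_sub_cancel]
    push_cast
    ring

theorem tendsto_natCast_mul_casoratian {v w : ℕ → ℂ}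
    (hv : Summable fun k : ℕ => (k + 1) * ‖v k‖) {C : ℝ} (hw : ∀ k, ‖w k‖ ≤ C) :
    Tendsto (fun N : ℕ => N * (v N * w (N - 1) - v (N - 1) * w N)) atTop (𝓝 0) := by
  rw [← tendsto_add_atTop_iff_nat 1]
  have hv0 := hv.tendsto_atTop_zero
  have hmajorant := (((tendsto_add_atTop_iff_nat 1).2 hv0).add hv0).const_mul C
  rw [add_zero, mul_zero] at hmajorant
  refine squeeze_zero_norm (fun N => ?_) hmajorant
  have hdiff : ‖v (N + 1) * w N - v N * w (N + 1)‖ ≤ C * (‖v (N + 1)‖ + ‖v N‖) := by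
    refine (norm_sub_le _ _).trans ?_
    rw [norm_mul, norm_mul]
    nlinarith [hw N, hw (N + 1), norm_nonneg (v (N + 1)), norm_nonneg (v N)]
  have hC : 0 ≤ C := (norm_nonneg _).trans (hw 0)
  calc ‖((N + 1 : ℕ) : ℂ) * (v (N + 1) * w (N + 1 - 1) - v (N + 1 - 1) * w (N + 1))‖
      = (N + 1) * ‖v (N + 1) * w N - v N * w (N + 1)‖ := by
        rw [norm_mul, Complex.norm_natCast, Nat.cast_succ, Nat.add_sub_cancel]
    _ ≤ (N + 1) * (C * (‖v (N + 1)‖ + ‖v N‖)) := by gcongr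
    _ ≤ C * (((N + 1 : ℕ) + 1) * ‖v (N + 1)‖ + (N + 1) * ‖v N‖) := by
        push_cast
        nlinarith [mul_nonneg hC (norm_nonneg (v (N + 1)))]

theorem tsum_laguerreTau_mul {v w : ℕ → ℂ} (hv : Summable fun k : ℕ => (k + 1) * ‖v k‖) {C : ℝ}
    (hw : ∀ k, ‖w k‖ ≤ C) :
    ∑' k, laguerreTau v k * w k = ∑' k, v k * laguerreTau w k := by
  have hleft : Summable fun k => laguerreTau v k * w k := by
    refine .of_norm_bounded ((summable_norm_laguerreTau hv).mul_right C) fun k => ?_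
    rw [norm_mul]
    gcongr
    exact hw k
  have hright : Summable fun k => v k * laguerreTau w k := by
    refine .of_norm_bounded (hv.mul_left (4 * C)) fun k => ?_
    rw [norm_mul]
    nlinarith [norm_laguerreTau_apply_le_of_forall_norm_le hw k, norm_nonneg (v k)]
  have hsum := (hleft.sub hright).hasSum.tendsto_sum_nat
  simp only [sum_range_laguerreTau_mul_sub] at hsum
  rw [← sub_eq_zero, ← hleft.tsum_sub hright]
  exact tendsto_nhds_unique hsum (tendsto_natCast_mul_casoratian hv hw)

-- The coefficient of `F n (m + 1)` in `laguerreTau (F n) m` is nonzero, so the symmetry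
-- determines each column from the two preceding ones.
theorem eq_of_laguerreTau_symm {F G : ℕ → ℕ → ℂ}
    (hF : ∀ n m, laguerreTau (F n) m = laguerreTau (fun i => F i m) n)
    (hG : ∀ n m, laguerreTau (G n) m = laguerreTau (fun i => G i m) n)
    (h0 : ∀ n, F n 0 = G n 0) (n m : ℕ) : F n m = G n m := by
  induction m using Nat.strong_induction_on generalizing n with
  | _ m ih =>
    cases m with
    | zero => exact h0 n
    | succ m =>
      have hcol : (fun i => F i m) = fun i => G i m := funext fun i => ih m m.lt_succ_self i
      have hrow : laguerreTau (F n) m = laguerreTau (G n) m := by rw [hF, hG, hcol]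
      rw [laguerreTau_apply, laguerreTau_apply, ih m m.lt_succ_self, ih (m - 1) (by lia)] at hrow
      exact mul_left_cancel₀ (Nat.cast_add_one_ne_zero m) (add_left_cancel hrow)

/-! ### The kernel as a polynomial -/

/-- `choosePow a j n = C(n, j) a ^ (n - j)` is the coefficient of `X ^ n` in
`X ^ j / (1 - a X) ^ (j + 1)`. As functions of `n`, these sequences form a basis in which `τ` is
again tridiagonal, and the kernel of `exp(-itH₀)` is diagonal. -/
def choosePow {R : Type*} [CommRing R] (a : R) (j n : ℕ) : R := n.choose j * a ^ (n - j)

section CommRing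

variable {R : Type*} [CommRing R] (a : R) (j n : ℕ)

theorem choosePow_eq_zero_of_lt {j n : ℕ} (h : n < j) : choosePow a j n = 0 := by
  rw [choosePow, Nat.choose_eq_zero_of_lt h, Nat.cast_zero, zero_mul]

theorem choosePow_zero_left : choosePow a 0 n = a ^ n := by
  rw [choosePow, Nat.choose_zero_right, Nat.cast_one, one_mul, Nat.sub_zero]

theorem choosePow_zero_base : choosePow (0 : R) j n = if n = j then 1 else 0 := by
  rcases lt_trichotomy n j with h | rfl | h
  · rw [choosePow_eq_zero_of_lt _ h, if_neg h.ne]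
  · simp [choosePow]
  · simp [choosePow, h.ne', (Nat.sub_pos_of_lt h).ne']

theorem mul_choosePow_succ : a * choosePow a (j + 1) n = n.choose (j + 1) * a ^ (n - j) := by
  rcases lt_or_ge j n with h | h
  · rw [choosePow, mul_left_comm, ← pow_succ', Nat.sub_add_eq, Nat.sub_add_cancel (by lia)]
  · rw [choosePow_eq_zero_of_lt a (by lia), Nat.choose_eq_zero_of_lt (by lia), Nat.cast_zero,
      mul_zero, zero_mul]

theorem choosePow_succ_succ :
    choosePow a (j + 1) (n + 1) = choosePow a j n + a * choosePow a (j + 1) n := by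
  rw [mul_choosePow_succ, choosePow, choosePow, Nat.choose_succ_succ, Nat.add_sub_add_right]
  push_cast
  ring

theorem succ_mul_choosePow :
    (n + 1) * choosePow a j n = (j + 1) * choosePow a (j + 1) (n + 1) := by
  have h : ((n : R) + 1) * n.choose j = (n + 1).choose (j + 1) * (j + 1) :=
    mod_cast congrArg (Nat.cast (R := R)) (Nat.add_one_mul_choose_eq n j)
  rw [choosePow, choosePow, Nat.add_sub_add_right]
  linear_combination a ^ (n - j) * h

theorem natCast_mul_choosePow :
    n * choosePow a j n = j * choosePow a j n + (j + 1) * (a * choosePow a (j + 1) n) := by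
  rw [mul_choosePow_succ, choosePow]
  rcases lt_or_ge n j with h | h
  · simp [Nat.choose_eq_zero_of_lt h, Nat.choose_eq_zero_of_lt (h.trans j.lt_succ_self)]
  · have hchoose : (n.choose (j + 1) : R) * (j + 1) = n.choose j * (n - j) := by
      rw [← Nat.cast_sub h]
      exact_mod_cast congrArg (Nat.cast (R := R)) (Nat.choose_succ_right_eq n j)
    linear_combination (-a ^ (n - j)) * hchoose

theorem natCast_mul_choosePow_pred :
    n * choosePow a j (n - 1) = (j + 1) * choosePow a (j + 1) n := by
  cases n with
  | zero => simp [choosePow]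
  | succ n => simpa using succ_mul_choosePow a j n

theorem succ_mul_choosePow_succ_right :
    (n + 1) * choosePow a j (n + 1) = j * choosePow a (j - 1) n +
      (2 * j + 1) * a * choosePow a j n + (j + 1) * a ^ 2 * choosePow a (j + 1) n := by
  have hj := natCast_mul_choosePow a j n
  cases j with
  | zero =>
    simp only [choosePow_zero_left, Nat.cast_zero] at hj ⊢
    linear_combination a * hj
  | succ i =>
    rw [choosePow_succ_succ, Nat.add_sub_cancel]
    push_cast at hj ⊢
    linear_combination a * hj + natCast_mul_choosePow a i n

end CommRing

theorem laguerreTau_choosePow (a : ℂ) (j n : ℕ) :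
    laguerreTau (choosePow a j) n =
      (j + 1) * (1 + a) ^ 2 * choosePow a (j + 1) n + (2 * j + 1) * (1 + a) * choosePow a j n
        + j * choosePow a (j - 1) n := by
  rw [laguerreTau_apply]
  linear_combination natCast_mul_choosePow_pred a j n + 2 * natCast_mul_choosePow a j n +
    succ_mul_choosePow_succ_right a j n

theorem hasDerivAt_choosePow {𝕜 : Type*} [NontriviallyNormedField 𝕜] (a : 𝕜) (j n : ℕ) :
    HasDerivAt (fun a => choosePow a j n) ((j + 1) * choosePow a (j + 1) n) a := by
  refine ((hasDerivAt_pow (n - j) a).const_mul (n.choose j : 𝕜)).congr_deriv ?_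
  have hchoose : (n.choose (j + 1) : 𝕜) * (j + 1) = n.choose j * (n - j : ℕ) :=
    mod_cast congrArg (Nat.cast (R := 𝕜)) (Nat.choose_succ_right_eq n j)
  rw [choosePow, Nat.sub_add_eq]
  linear_combination (-a ^ (n - j - 1)) * hchoose

theorem hasSum_choosePow_mul_pow {𝕜 : Type*} [NormedField 𝕜] {a c : 𝕜} (h : ‖a * c‖ < 1) (j : ℕ) :
    HasSum (fun k => choosePow a j k * c ^ k) (c ^ j / (1 - a * c) ^ (j + 1)) := by
  have hgeom := (hasSum_choose_mul_geometric_of_norm_lt_one j h).mul_left (c ^ j)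
  have hinit : ∑ k ∈ range j, choosePow a j k * c ^ k = 0 :=
    sum_eq_zero fun k hk => by rw [choosePow_eq_zero_of_lt a (mem_range.1 hk), zero_mul]
  rw [← hasSum_nat_add_iff' j, hinit, sub_zero, div_eq_mul_one_div]
  refine hgeom.congr_fun fun k => ?_
  rw [choosePow, Nat.add_sub_cancel]
  ring

theorem summable_norm_choosePow {𝕜 : Type*} [RCLike 𝕜] {a : 𝕜} (h : ‖a‖ < 1) (j : ℕ) :
    Summable fun k => ‖choosePow a j k‖ := by
  rw [← summable_nat_add_iff j]
  simpa [choosePow] using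
    summable_choose_mul_geometric_of_norm_lt_one j (r := ‖a‖) (by rwa [norm_norm])

theorem summable_succ_mul_norm_choosePow {𝕜 : Type*} [RCLike 𝕜] {a : 𝕜} (h : ‖a‖ < 1) (j : ℕ) :
    Summable fun k : ℕ => (k + 1) * ‖choosePow a j k‖ := by
  have hnorm : ∀ k : ℕ, ‖(k : 𝕜) + 1‖ = k + 1 := fun k =>
    mod_cast RCLike.norm_natCast (K := 𝕜) (k + 1)
  refine (((summable_nat_add_iff 1).2 (summable_norm_choosePow h (j + 1))).mul_left
    ((j : ℝ) + 1)).congr fun k => ?_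
  rw [← hnorm, ← hnorm k, ← norm_mul, ← norm_mul, succ_mul_choosePow]

/-- The kernel of `exp(-itH₀)`, written as a polynomial in `b = 1 / (1 + it)`. -/
def laguerreKernel {R : Type*} [CommRing R] (b : R) (n m : ℕ) : R :=
  ∑ j ∈ range (n + 1), b ^ (2 * j + 1) * choosePow (b - 1) j n * choosePow (b - 1) j m

section CommRing

variable {R : Type*} [CommRing R] (b : R)

theorem laguerreKernel_eq_sum_range {n N : ℕ} (h : n < N) (m : ℕ) :
    laguerreKernel b n m =
      ∑ j ∈ range N, b ^ (2 * j + 1) * choosePow (b - 1) j n * choosePow (b - 1) j m := by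
  refine sum_subset (range_mono h) fun j _ hj => ?_
  rw [choosePow_eq_zero_of_lt _ (by simpa using hj), mul_zero, zero_mul]

theorem laguerreKernel_comm (n m : ℕ) : laguerreKernel b n m = laguerreKernel b m n := by
  rw [laguerreKernel_eq_sum_range b (N := n + m + 1) (by lia),
    laguerreKernel_eq_sum_range b (N := n + m + 1) (by lia)]
  exact sum_congr rfl fun j _ => mul_right_comm _ _ _

theorem laguerreKernel_zero_left (m : ℕ) : laguerreKernel b 0 m = b * (b - 1) ^ m := by
  simp [laguerreKernel, choosePow]

theorem laguerreKernel_one (n m : ℕ) : laguerreKernel (1 : R) n m = if n = m then 1 else 0 := by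
  simp only [laguerreKernel, sub_self, choosePow_zero_base, one_pow, mul_ite, mul_one, mul_zero]
  rw [sum_eq_single n (fun j _ hj => by simp [hj.symm]) (by simp)]
  simp [eq_comm]

theorem map_laguerreKernel {S : Type*} [CommRing S] (f : R →+* S) (n m : ℕ) :
    f (laguerreKernel b n m) = laguerreKernel (f b) n m := by
  simp [laguerreKernel, choosePow]

end CommRing

theorem laguerreTau_laguerreKernel_left_eq_sum (b : ℂ) (n : ℕ) {m N : ℕ} (hm : m < N) :
    laguerreTau (fun k => laguerreKernel b k m) n =
      ∑ j ∈ range N, ((2 * j + 1) * b ^ (2 * j + 2) *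
          (choosePow (b - 1) j n * choosePow (b - 1) j m)
        + (j + 1) * b ^ (2 * j + 3) * (choosePow (b - 1) (j + 1) n * choosePow (b - 1) j m
          + choosePow (b - 1) j n * choosePow (b - 1) (j + 1) m)) := by
  set p := choosePow (b - 1)
  have hexpand : (fun k => laguerreKernel b k m) =
      ∑ j ∈ range (N + 1), (b ^ (2 * j + 1) * p j m) • p j := by
    funext k
    rw [laguerreKernel_comm, laguerreKernel_eq_sum_range b (hm.trans N.lt_succ_self),
      Finset.sum_apply]
    rfl
  have hτ : laguerreTau (fun k => laguerreKernel b k m) n = ∑ j ∈ range (N + 1),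
      (b ^ (2 * j + 1) * p j m * ((j + 1) * b ^ 2 * p (j + 1) n + (2 * j + 1) * b * p j n) +
        b ^ (2 * j + 1) * p j m * (j * p (j - 1) n)) := by
    rw [hexpand, map_sum, Finset.sum_apply]
    refine sum_congr rfl fun j _ => ?_
    rw [map_smul, Pi.smul_apply, smul_eq_mul, laguerreTau_choosePow, add_sub_cancel, ← mul_add]
  have hlast : p N m = 0 := choosePow_eq_zero_of_lt _ hm
  rw [hτ, sum_add_distrib, sum_range_succ, sum_range_succ' (fun j : ℕ => _ * (j * p (j - 1) n)),
    hlast]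
  simp only [mul_zero, zero_mul, Nat.cast_zero, add_zero, Nat.add_sub_cancel, ← sum_add_distrib]
  refine sum_congr rfl fun j _ => ?_
  push_cast
  ring

theorem laguerreTau_laguerreKernel_symm (b : ℂ) (n m : ℕ) :
    laguerreTau (laguerreKernel b n) m = laguerreTau (fun k => laguerreKernel b k m) n := by
  have hrow : laguerreKernel b n = fun k => laguerreKernel b k n :=
    funext fun k => laguerreKernel_comm b n k
  rw [hrow, laguerreTau_laguerreKernel_left_eq_sum b n (N := n + m + 1) (by lia),
    laguerreTau_laguerreKernel_left_eq_sum b m (N := n + m + 1) (by lia)]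
  exact sum_congr rfl fun j _ => by ring

theorem laguerreTau_laguerreKernel (b : ℂ) (n m : ℕ) : laguerreTau (laguerreKernel b n) m =
    n * laguerreKernel b (n - 1) m + (2 * n + 1) * laguerreKernel b n m
      + (n + 1) * laguerreKernel b (n + 1) m := by
  rw [laguerreTau_laguerreKernel_symm, laguerreTau_apply]

theorem hasDerivAt_laguerreKernel {b : ℂ} (hb : b ≠ 0) (n m : ℕ) :
    HasDerivAt (fun b => laguerreKernel b n m) (laguerreTau (laguerreKernel b n) m / b ^ 2) b := by
  have hp : ∀ j k, HasDerivAt (fun b : ℂ => choosePow (b - 1) j k)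
      ((j + 1) * choosePow (b - 1) (j + 1) k) b :=
    fun j k => (hasDerivAt_choosePow (b - 1) j k).comp_sub_const b 1
  rw [laguerreTau_laguerreKernel_symm,
    laguerreTau_laguerreKernel_left_eq_sum b n (N := n + m + 1) (by lia)]
  simp only [laguerreKernel_eq_sum_range _ (show n < n + m + 1 by lia)]
  refine (HasDerivAt.fun_sum fun j _ => ((hasDerivAt_pow (2 * j + 1) b).fun_mul
    (hp j n)).fun_mul (hp j m)).congr_deriv ?_
  rw [eq_div_iff (pow_ne_zero 2 hb), sum_mul]
  refine sum_congr rfl fun j _ => ?_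
  rw [Nat.add_sub_cancel]
  push_cast
  ring

theorem hasSum_laguerreKernel_mul_pow {𝕜 : Type*} [NormedField 𝕜] {b c : 𝕜}
    (h : ‖(b - 1) * c‖ < 1) (n : ℕ) :
    HasSum (fun k => laguerreKernel b n k * c ^ k)
      (b / (1 - (b - 1) * c) * (b - 1 + b ^ 2 * c / (1 - (b - 1) * c)) ^ n) := by
  have hterms : HasSum (fun k => ∑ j ∈ range (n + 1),
      b ^ (2 * j + 1) * choosePow (b - 1) j n * (choosePow (b - 1) j k * c ^ k))
      (∑ j ∈ range (n + 1), b ^ (2 * j + 1) * choosePow (b - 1) j n *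
        (c ^ j / (1 - (b - 1) * c) ^ (j + 1))) :=
    hasSum_sum fun j _ => (hasSum_choosePow_mul_pow h j).mul_left _
  have hbinom : b / (1 - (b - 1) * c) * (b - 1 + b ^ 2 * c / (1 - (b - 1) * c)) ^ n =
      ∑ j ∈ range (n + 1), b ^ (2 * j + 1) * choosePow (b - 1) j n *
        (c ^ j / (1 - (b - 1) * c) ^ (j + 1)) := by
    rw [add_comm (b - 1), add_pow, mul_sum]
    refine sum_congr rfl fun j _ => ?_
    rw [choosePow, div_pow, mul_pow]
    generalize 1 - (b - 1) * c = d
    ring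
  rw [hbinom]
  refine hterms.congr_fun fun k => ?_
  simp only [laguerreKernel, sum_mul, mul_assoc]

section RCLike

variable {𝕜 : Type*} [RCLike 𝕜] {b : 𝕜}

theorem summable_succ_mul_norm_laguerreKernel (h : ‖b - 1‖ < 1) (n : ℕ) :
    Summable fun k : ℕ => (k + 1) * ‖laguerreKernel b n k‖ := by
  have hmajorant : Summable fun k : ℕ => ∑ j ∈ range (n + 1),
      ‖b ^ (2 * j + 1) * choosePow (b - 1) j n‖ * ((k + 1) * ‖choosePow (b - 1) j k‖) :=
    summable_sum fun j _ => (summable_succ_mul_norm_choosePow h j).mul_left _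
  refine .of_nonneg_of_le (fun k => by positivity) (fun k => ?_) hmajorant
  refine (mul_le_mul_of_nonneg_left (norm_sum_le _ _) (by positivity)).trans_eq ?_
  simp only [mul_sum, norm_mul, mul_left_comm]

theorem summable_norm_laguerreKernel (h : ‖b - 1‖ < 1) (n : ℕ) :
    Summable fun k => ‖laguerreKernel b n k‖ :=
  .of_nonneg_of_le (fun _ => norm_nonneg _)
    (fun k => le_mul_of_one_le_left (norm_nonneg _) (by simp))
    (summable_succ_mul_norm_laguerreKernel h n)

theorem norm_laguerreKernel_le_tsum (h : ‖b - 1‖ < 1) (n k : ℕ) :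
    ‖laguerreKernel b n k‖ ≤ ∑' i, ‖laguerreKernel b n i‖ :=
  (summable_norm_laguerreKernel h n).le_tsum k fun _ _ => norm_nonneg _

theorem summable_laguerreKernel_mul (h : ‖b - 1‖ < 1) (n : ℕ) {w : ℕ → 𝕜} {C : ℝ}
    (hw : ∀ k, ‖w k‖ ≤ C) : Summable fun k => laguerreKernel b n k * w k := by
  refine .of_norm_bounded ((summable_norm_laguerreKernel h n).mul_right C) fun k => ?_
  rw [norm_mul]
  exact mul_le_mul_of_nonneg_left (hw k) (norm_nonneg _)

end RCLike

theorem tsum_laguerreKernel_mul_laguerreTau {b : ℂ} (h : ‖b - 1‖ < 1) (n : ℕ) {w : ℕ → ℂ} {C : ℝ}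
    (hw : ∀ k, ‖w k‖ ≤ C) : ∑' k, laguerreKernel b n k * laguerreTau w k =
      laguerreTau (fun i => ∑' k, laguerreKernel b i k * w k) n := by
  have hs := fun i => (summable_laguerreKernel_mul h i hw).hasSum
  have hτ := (((hs (n - 1)).mul_left (n : ℂ)).add ((hs n).mul_left (2 * n + 1 : ℂ))).add
    ((hs (n + 1)).mul_left (n + 1 : ℂ))
  rw [← tsum_laguerreTau_mul (summable_succ_mul_norm_laguerreKernel h n) hw, laguerreTau_apply]
  refine (hτ.congr_fun fun k => ?_).tsum_eq
  rw [laguerreTau_laguerreKernel]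
  ring

-- The `τ`-symmetry reduces the identity to `m = 0`, where it is a geometric-type series.
theorem tsum_laguerreKernel_mul_laguerreKernel {b c : ℂ} (hb : ‖b - 1‖ < 1) (hc : ‖c - 1‖ < 1)
    (n m : ℕ) : ∑' k, laguerreKernel b n k * laguerreKernel c m k =
      laguerreKernel (b * c / (1 - (b - 1) * (c - 1))) n m := by
  have hbc : ‖(b - 1) * (c - 1)‖ < 1 := by
    rw [norm_mul]
    exact mul_lt_one_of_nonneg_of_lt_one_left (norm_nonneg _) hb hc.le
  refine eq_of_laguerreTau_symm (F := fun n m => ∑' k, laguerreKernel b n k * laguerreKernel c m k)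
    (fun n m => ?_) (laguerreTau_laguerreKernel_symm _) (fun n => ?_) n m
  · rw [← tsum_laguerreKernel_mul_laguerreTau hb n (norm_laguerreKernel_le_tsum hc m),
      ← tsum_laguerreTau_mul (summable_succ_mul_norm_laguerreKernel hb n)
        (norm_laguerreKernel_le_tsum hc m)]
    simp only [mul_comm (laguerreKernel b n _), mul_comm _ (laguerreKernel c m _)]
    exact (tsum_laguerreKernel_mul_laguerreTau hc m (norm_laguerreKernel_le_tsum hb n)).symm
  · have hd : 1 - (b - 1) * (c - 1) ≠ 0 := fun h => by
      rw [← sub_eq_zero.1 h, norm_one] at hbc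
      exact hbc.false
    have hratio : b * c / (1 - (b - 1) * (c - 1)) - 1 =
        b - 1 + b ^ 2 * (c - 1) / (1 - (b - 1) * (c - 1)) := by
      field_simp
      ring
    rw [laguerreKernel_comm, laguerreKernel_zero_left, hratio]
    have hsum := (hasSum_laguerreKernel_mul_pow hbc n).mul_left c
    refine (hsum.congr_fun fun k => ?_).tsum_eq.trans ?_
    · rw [laguerreKernel_zero_left]
      ring
    · ring

/-! ### Symmetric powers of unitary matrices -/

open Polynomial in
theorem coeff_C_mul_X_add_C_pow {R : Type*} [CommSemiring R] (a b : R) (n k : ℕ) :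
    ((C a * X + C b) ^ n).coeff k = n.choose k * a ^ k * b ^ (n - k) := by
  have hterm : ∀ i, ((C a * X) ^ i * C b ^ (n - i) * (n.choose i : R[X])).coeff k =
      if k = i then n.choose i * a ^ i * b ^ (n - i) else 0 := fun i => by
    rw [← coeff_C_mul_X_pow]
    simp only [map_mul, map_pow, map_natCast]
    ring_nf
  simp only [add_pow, finsetSum_coeff, hterm, sum_ite_eq, mem_range]
  split_ifs with hk
  · rfl
  · simp [Nat.choose_eq_zero_of_lt (show n < k by lia)]

open Polynomial in
/-- The image of `X ^ k Y ^ (N - k)` under the action of the `2 × 2` matrix `A` on binary forms of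
degree `N`, dehomogenized at `Y = 1`. Its coefficients form a column of the `N`-th symmetric power
of `A` in the monomial basis. -/
noncomputable def symPowForm {R : Type*} [CommSemiring R] (A : Matrix (Fin 2) (Fin 2) R)
    (N k : ℕ) : R[X] :=
  (C (A 0 0) * X + C (A 0 1)) ^ k * (C (A 1 0) * X + C (A 1 1)) ^ (N - k)

section UnitaryGroup

open Polynomial

variable {A : Matrix (Fin 2) (Fin 2) ℂ}

theorem sum_choose_mul_symPowForm_mul_map_star (hA : A ∈ Matrix.unitaryGroup (Fin 2) ℂ) (N : ℕ) :
    ∑ k ∈ range (N + 1), C (symPowForm A N k) * ((symPowForm A N k).map (starRingEnd ℂ)).map C *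
      (N.choose k : ℂ[X][X]) = (C X * X + C 1) ^ N := by
  rw [Matrix.mem_unitaryGroup_iff'] at hA
  have hcols := fun i j => congrArg (fun z => (C (C z) : ℂ[X][X])) (congrFun₂ hA i j)
  simp only [Matrix.mul_apply, Fin.sum_univ_two, Matrix.star_apply, Matrix.one_apply,
    RCLike.star_def] at hcols
  have hlin : (C X * X + C 1 : ℂ[X][X]) =
      C (C (A 0 0) * X + C (A 0 1)) * ((C (A 0 0) * X + C (A 0 1)).map (starRingEnd ℂ)).map C +
      C (C (A 1 0) * X + C (A 1 1)) * ((C (A 1 0) * X + C (A 1 1)).map (starRingEnd ℂ)).map C := by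
    have h00 := hcols 0 0
    have h01 := hcols 0 1
    have h10 := hcols 1 0
    have h11 := hcols 1 1
    simp only [↓reduceIte, Fin.isValue, zero_ne_one, one_ne_zero, map_add, map_mul, map_one,
      map_zero, Polynomial.map_add, Polynomial.map_mul, map_C, map_X] at h00 h01 h10 h11 ⊢
    linear_combination -C X * X * h00 - X * h01 - C X * h10 - h11
  rw [hlin, add_pow]
  refine sum_congr rfl fun k _ => ?_
  simp only [symPowForm, map_mul, map_pow, Polynomial.map_mul, Polynomial.map_pow]
  ring

theorem sum_choose_mul_normSq_coeff_symPowForm (hA : A ∈ Matrix.unitaryGroup (Fin 2) ℂ)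
    (N n : ℕ) : ∑ k ∈ range (N + 1), (N.choose k : ℝ) * ‖(symPowForm A N k).coeff n‖ ^ 2 =
      N.choose n := by
  have hcoeff := congrArg (fun p : ℂ[X][X] => (p.coeff n).coeff n)
    (sum_choose_mul_symPowForm_mul_map_star hA N)
  have hterm : ∀ k, ((C (symPowForm A N k) * ((symPowForm A N k).map (starRingEnd ℂ)).map C *
      (N.choose k : ℂ[X][X])).coeff n).coeff n =
      ((N.choose k * ‖(symPowForm A N k).coeff n‖ ^ 2 : ℝ) : ℂ) := fun k => by
    rw [mul_comm, ← C_eq_natCast, ← mul_assoc, ← C_mul, coeff_C_mul, coeff_map, coeff_mul_C,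
      ← C_eq_natCast, coeff_C_mul, coeff_map, mul_assoc, Complex.mul_conj,
      Complex.normSq_eq_norm_sq]
    push_cast
    rfl
  simp only [finsetSum_coeff, hterm, coeff_C_mul_X_add_C_pow, one_pow, mul_one] at hcoeff
  rw [← C_eq_natCast, coeff_C_mul_X_pow, if_pos rfl] at hcoeff
  exact_mod_cast hcoeff

theorem norm_coeff_symPowForm_self_le_one (hA : A ∈ Matrix.unitaryGroup (Fin 2) ℂ) {N n : ℕ}
    (h : n ≤ N) : ‖(symPowForm A N n).coeff n‖ ≤ 1 := by
  have hsum := sum_choose_mul_normSq_coeff_symPowForm hA N n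
  have hle : (N.choose n : ℝ) * ‖(symPowForm A N n).coeff n‖ ^ 2 ≤ N.choose n * 1 :=
    (single_le_sum (f := fun k => (N.choose k : ℝ) * ‖(symPowForm A N k).coeff n‖ ^ 2)
      (fun k _ => by positivity) (mem_range.2 (Nat.lt_succ_of_le h))).trans_eq
        (hsum.trans (mul_one _).symm)
  have hpos : (0 : ℝ) < N.choose n := mod_cast Nat.choose_pos h
  exact (sq_le_one_iff₀ (norm_nonneg _)).1 (le_of_mul_le_mul_left hle hpos)

end UnitaryGroup

theorem laguerreKernel_eq_mul_coeff_symPowForm {R : Type*} [CommRing R] (b : R) (n m : ℕ) :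
    laguerreKernel b n m = b * (symPowForm !![b - 1, b; b, b - 1] (n + m) n).coeff n := by
  rw [symPowForm, Nat.add_sub_cancel_left, Polynomial.coeff_mul,
    Nat.sum_antidiagonal_eq_sum_range_succ_mk, ← sum_range_reflect, laguerreKernel, mul_sum]
  refine sum_congr rfl fun j hj => ?_
  have hj : j ≤ n := Nat.lt_succ_iff.1 (mem_range.1 hj)
  have hsub : n + 1 - 1 - j = n - j := rfl
  simp only [Matrix.of_apply, Matrix.cons_val', Matrix.cons_val_zero, Matrix.cons_val_one,
    Matrix.cons_val_fin_one, coeff_C_mul_X_add_C_pow, choosePow, hsub, Nat.choose_symm hj,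
    Nat.sub_sub_self hj]
  ring

theorem mem_unitaryGroup_of_normSq_eq_re {b : ℂ} (hb : Complex.normSq b = b.re) :
    !![b - 1, b; b, b - 1] ∈ Matrix.unitaryGroup (Fin 2) ℂ := by
  have hstar : 2 * (b * (starRingEnd ℂ) b) = b + (starRingEnd ℂ) b := by
    rw [Complex.mul_conj, hb, Complex.add_conj]
    push_cast
    rfl
  rw [Matrix.mem_unitaryGroup_iff]
  ext i j
  fin_cases i <;> fin_cases j <;> simp [Matrix.mul_apply, Fin.sum_univ_two] <;>
    linear_combination hstar

theorem norm_laguerreKernel_le {b : ℂ} (hb : Complex.normSq b = b.re) (n m : ℕ) :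
    ‖laguerreKernel b n m‖ ≤ ‖b‖ := by
  rw [laguerreKernel_eq_mul_coeff_symPowForm, norm_mul]
  exact mul_le_of_le_one_right (norm_nonneg _)
    (norm_coeff_symPowForm_self_le_one (mem_unitaryGroup_of_normSq_eq_re hb) (n.le_add_right m))

/-! ### The kernel along the circle `|b| ^ 2 = Re b` -/

/-- The `(0, 0)` entry of `exp(-itH₀)`. As `t` varies it runs through the circle
`|b| ^ 2 = Re b` without the origin. -/
noncomputable def laguerreParam (t : ℝ) : ℂ := 1 / (1 + t * Complex.I)

theorem one_add_mul_I_ne_zero (t : ℝ) : (1 : ℂ) + t * Complex.I ≠ 0 := fun h => by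
  simpa using congrArg Complex.re h

theorem laguerreParam_zero : laguerreParam 0 = 1 := by simp [laguerreParam]

theorem laguerreParam_ne_zero (t : ℝ) : laguerreParam t ≠ 0 :=
  one_div_ne_zero (one_add_mul_I_ne_zero t)

theorem conj_laguerreParam (t : ℝ) : (starRingEnd ℂ) (laguerreParam t) = laguerreParam (-t) := by
  simp [laguerreParam]

theorem norm_laguerreParam (t : ℝ) : ‖laguerreParam t‖ = 1 / √(1 + t ^ 2) := by
  rw [laguerreParam, norm_div, norm_one, ← Complex.ofReal_one, Complex.norm_add_mul_I, one_pow]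

theorem normSq_laguerreParam (t : ℝ) : Complex.normSq (laguerreParam t) = (laguerreParam t).re := by
  simp [laguerreParam, Complex.inv_re]

theorem norm_laguerreParam_sub_one_lt (t : ℝ) : ‖laguerreParam t - 1‖ < 1 := by
  have hsub : Complex.normSq (laguerreParam t - 1) = 1 - Complex.normSq (laguerreParam t) := by
    rw [Complex.normSq_sub, map_one, map_one, mul_one, ← normSq_laguerreParam]
    ring
  have hpos := Complex.normSq_pos.2 (laguerreParam_ne_zero t)
  rw [← sq_lt_one_iff₀ (norm_nonneg _), ← Complex.normSq_eq_norm_sq, hsub]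
  linarith

theorem laguerreParam_add (s t : ℝ) : laguerreParam (s + t) =
    laguerreParam s * laguerreParam t / (1 - (laguerreParam s - 1) * (laguerreParam t - 1)) := by
  have hs := mul_one_div_cancel (one_add_mul_I_ne_zero s)
  have ht := mul_one_div_cancel (one_add_mul_I_ne_zero t)
  rw [← laguerreParam] at hs ht
  have hden : 1 - (laguerreParam s - 1) * (laguerreParam t - 1) =
      (1 + (s + t : ℝ) * Complex.I) * (laguerreParam s * laguerreParam t) := by
    push_cast
    linear_combination -laguerreParam t * hs - laguerreParam s * ht
  rw [hden, div_mul_cancel_right₀ (mul_ne_zero (laguerreParam_ne_zero s) (laguerreParam_ne_zero t)),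
    laguerreParam, one_div]

theorem hasDerivAt_laguerreParam (t : ℝ) :
    HasDerivAt laguerreParam (-Complex.I * laguerreParam t ^ 2) t := by
  have hden : HasDerivAt (fun t : ℝ => (1 : ℂ) + t * Complex.I) Complex.I t := by
    simpa using ((hasDerivAt_id t).ofReal_comp.mul_const Complex.I).const_add 1
  have hinv : laguerreParam = fun t : ℝ => ((1 : ℂ) + t * Complex.I)⁻¹ :=
    funext fun t => one_div _
  rw [hinv]
  refine (hden.fun_inv (one_add_mul_I_ne_zero t)).congr_deriv ?_
  rw [inv_pow, div_eq_mul_inv]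

theorem hasDerivAt_laguerreKernel_laguerreParam (t : ℝ) (n m : ℕ) :
    HasDerivAt (fun t => laguerreKernel (laguerreParam t) n m)
      (-Complex.I * laguerreTau (laguerreKernel (laguerreParam t) n) m) t := by
  have hb := laguerreParam_ne_zero t
  refine ((hasDerivAt_laguerreKernel hb n m).comp t (hasDerivAt_laguerreParam t)).congr_deriv ?_
  field_simp

theorem conj_laguerreKernel_laguerreParam (t : ℝ) (n m : ℕ) :
    (starRingEnd ℂ) (laguerreKernel (laguerreParam t) n m) =
      laguerreKernel (laguerreParam (-t)) n m := by
  rw [map_laguerreKernel, conj_laguerreParam]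

theorem tsum_laguerreKernel_mul_laguerreKernel_laguerreParam (s t : ℝ) (n m : ℕ) :
    ∑' k, laguerreKernel (laguerreParam s) n k * laguerreKernel (laguerreParam t) m k =
      laguerreKernel (laguerreParam (s + t)) n m := by
  rw [tsum_laguerreKernel_mul_laguerreKernel (norm_laguerreParam_sub_one_lt s)
    (norm_laguerreParam_sub_one_lt t), laguerreParam_add]

/-! ### Evolution groups -/

theorem tendsto_I_div_smul_iff_hasDerivAt {E : Type*} [NormedAddCommGroup E] [NormedSpace ℂ E]
    (g : ℝ → E) (f : E) :
    Tendsto (fun t : ℝ => (Complex.I / (t : ℂ)) • (g t - g 0)) (𝓝[≠] 0) (𝓝 f) ↔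
      HasDerivAt g (-Complex.I • f) 0 := by
  have hslope : ∀ t : ℝ, t⁻¹ • (g (0 + t) - g 0) =
      -Complex.I • (Complex.I / (t : ℂ)) • (g t - g 0) := fun t => by
    rw [zero_add, smul_smul, neg_mul, ← mul_div_assoc, Complex.I_mul_I, ← neg_div, neg_neg,
      one_div, ← Complex.ofReal_inv, Complex.coe_smul]
  simp only [hasDerivAt_iff_tendsto_slope_zero, hslope]
  exact (tendsto_const_smul_iff₀ (neg_ne_zero.2 Complex.I_ne_zero)).symm

theorem norm_eq_of_hasDerivAt_neg_I_smul {E : Type*} [NormedAddCommGroup E]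
    [InnerProductSpace ℂ E] {A : E →ₗ.[ℂ] E} (hA : A.IsFormalAdjoint A) {w : ℝ → A.domain}
    (hw : ∀ t, HasDerivAt (fun t => (w t : E)) (-Complex.I • A (w t)) t) (s t : ℝ) :
    ‖(w s : E)‖ = ‖(w t : E)‖ := by
  have hderiv : ∀ t, HasDerivAt (fun t => inner ℂ (w t : E) (w t : E)) 0 t := fun t => by
    refine ((hw t).inner ℂ (hw t)).congr_deriv ?_
    rw [inner_smul_left, inner_smul_right, hA]
    simp
  have hconst := is_const_of_deriv_eq_zero (fun t => (hderiv t).differentiableAt)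
    (fun t => (hderiv t).deriv) s t
  simp only [inner_self_eq_norm_sq_to_K] at hconst
  exact (sq_eq_sq₀ (norm_nonneg _) (norm_nonneg _)).1 (mod_cast hconst)

namespace IsEvolutionGroup

variable {E : Type*} [NormedAddCommGroup E] [InnerProductSpace ℂ E] [CompleteSpace E]
  {A : E →ₗ.[ℂ] E} {U V : ℝ → E →L[ℂ] E}

theorem map_add_apply (hU : IsEvolutionGroup A U) (s t : ℝ) (u : E) :
    U (s + t) u = U s (U t u) := by
  rw [hU.map_add, mul_apply_eq_comp]

theorem hasDerivAt_zero_iff (hU : IsEvolutionGroup A U) (u f : E) :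
    HasDerivAt (fun t => U t u) (-Complex.I • f) 0 ↔ ∃ hu : u ∈ A.domain, A ⟨u, hu⟩ = f := by
  rw [← hU.generator, ← tendsto_I_div_smul_iff_hasDerivAt, hU.map_zero, one_apply_eq_self]

theorem hasDerivAt (hU : IsEvolutionGroup A U) (t : ℝ) (u : A.domain) :
    HasDerivAt (fun t => U t u) (-Complex.I • U t (A u)) t := by
  have hzero : HasDerivAt (fun s => U s (u : E)) (-Complex.I • A u) (t - t) := by
    rw [sub_self]
    exact (hU.hasDerivAt_zero_iff _ _).2 ⟨u.2, rfl⟩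
  have htrans := ((U t).restrictScalars ℝ).hasFDerivAt.comp_hasDerivAt t
    (hzero.comp_sub_const t t)
  simpa [Function.comp_def, ← hU.map_add_apply] using htrans

theorem map_mem_domain (hU : IsEvolutionGroup A U) (t : ℝ) (u : A.domain) :
    ∃ h : U t u ∈ A.domain, A ⟨U t u, h⟩ = U t (A u) := by
  refine (hU.hasDerivAt_zero_iff _ _).1 ?_
  have ht : HasDerivAt (fun s => U s (u : E)) (-Complex.I • U t (A u)) (0 + t) := by
    rw [zero_add]
    exact hU.hasDerivAt t u
  simpa [hU.map_add_apply] using ht.comp_add_const 0 t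

theorem isFormalAdjoint_self (hU : IsEvolutionGroup A U) : A.IsFormalAdjoint A := fun x y => by
  have hconst : ∀ t, inner ℂ (U t x) (U t y) = inner ℂ (x : E) (y : E) := fun t =>
    ContinuousLinearMap.inner_map_map_of_mem_unitary (hU.unitary t) _ _
  have hderiv := (hU.hasDerivAt 0 x).inner ℂ (hU.hasDerivAt 0 y)
  simp only [hconst, hU.map_zero, one_apply_eq_self, inner_smul_left, inner_smul_right,
    map_neg, Complex.conj_I] at hderiv
  refine mul_left_cancel₀ Complex.I_ne_zero ?_
  linear_combination hderiv.unique (hasDerivAt_const (0 : ℝ) _)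

theorem integral_mem_domain (hU : IsEvolutionGroup A U) (u : E) (h : ℝ) :
    ∫ s in 0..h, U s u ∈ A.domain := by
  have hcont := hU.continuous u
  have hshift : ∀ t, U t (∫ s in 0..h, U s u) =
      (∫ s in 0..(t + h), U s u) - ∫ s in 0..t, U s u := fun t => by
    rw [← (U t).intervalIntegral_comp_comm (hcont.intervalIntegrable _ _)]
    simp only [← hU.map_add_apply]
    rw [intervalIntegral.integral_comp_add_left (fun s => U s u), add_zero,
      intervalIntegral.integral_interval_sub_left (hcont.intervalIntegrable _ _)
        (hcont.intervalIntegrable _ _)]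
  have hderiv : HasDerivAt (fun t => U t (∫ s in 0..h, U s u)) (U h u - u) 0 := by
    simp only [hshift]
    have hleft : HasDerivAt (fun t => ∫ s in 0..t, U s u) (U h u) (0 + h) := by
      rw [zero_add]
      exact hcont.integral_hasStrictDerivAt 0 h |>.hasDerivAt
    have hright := (hcont.integral_hasStrictDerivAt 0 0).hasDerivAt
    rw [hU.map_zero] at hright
    exact (hleft.comp_add_const 0 h).fun_sub hright
  have hI : U h u - u = -Complex.I • Complex.I • (U h u - u) := by
    rw [smul_smul, neg_mul, Complex.I_mul_I, neg_neg, one_smul]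
  exact ((hU.hasDerivAt_zero_iff _ _).1 (hI ▸ hderiv)).1

theorem dense_domain (hU : IsEvolutionGroup A U) : Dense (A.domain : Set E) := fun u => by
  have hderiv := ((hU.continuous u).integral_hasStrictDerivAt 0 0).hasDerivAt
  simp only [hasDerivAt_iff_tendsto_slope_zero, intervalIntegral.integral_same, sub_zero,
    zero_add, hU.map_zero, one_apply_eq_self] at hderiv
  exact mem_closure_of_tendsto hderiv (.of_forall fun h =>
    A.domain.smul_of_tower_mem _ (hU.integral_mem_domain u h))

theorem unique (hU : IsEvolutionGroup A U) (hV : IsEvolutionGroup A V) : U = V := by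
  refine funext fun t => ContinuousLinearMap.coeFn_injective <|
    Continuous.ext_on hU.dense_domain (U t).continuous (V t).continuous fun y hy => ?_
  choose hUmem hUapply using fun s => hU.map_mem_domain s ⟨y, hy⟩
  choose hVmem hVapply using fun s => hV.map_mem_domain s ⟨y, hy⟩
  have hdiff : ∀ s, HasDerivAt (fun s => U s y - V s y)
      (-Complex.I • A (⟨U s y, hUmem s⟩ - ⟨V s y, hVmem s⟩)) s := fun s => by
    rw [A.map_sub, hUapply, hVapply, smul_sub]
    exact (hU.hasDerivAt s ⟨y, hy⟩).fun_sub (hV.hasDerivAt s ⟨y, hy⟩)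
  have hnorm := norm_eq_of_hasDerivAt_neg_I_smul hU.isFormalAdjoint_self
    (w := fun s => ⟨U s y, hUmem s⟩ - ⟨V s y, hVmem s⟩) hdiff t 0
  simpa [hU.map_zero, hV.map_zero, sub_eq_zero] using hnorm

end IsEvolutionGroup

/-! ### The unitary group of the Laguerre operator -/

theorem hasDerivAt_of_forall_hasDerivAt_comp {ι E F : Type*} [NormedAddCommGroup E]
    [NormedSpace ℝ E] [CompleteSpace E] [NormedAddCommGroup F] [NormedSpace ℝ F] [CompleteSpace F]
    {φ : ι → E →L[ℝ] F} (hφ : ∀ x y, (∀ i, φ i x = φ i y) → x = y) {f c : ℝ → E}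
    (hc : Continuous c) (h : ∀ i t, HasDerivAt (fun t => φ i (f t)) (φ i (c t)) t) (t : ℝ) :
    HasDerivAt f (c t) t := by
  have hf : f = fun t => f 0 + ∫ s in 0..t, c s := funext fun t => hφ _ _ fun i => by
    rw [_root_.map_add, ← (φ i).intervalIntegral_comp_comm (hc.intervalIntegrable 0 t),
      intervalIntegral.integral_eq_sub_of_hasDerivAt (fun s _ => h i s)
        (((φ i).continuous.comp hc).intervalIntegrable 0 t), add_sub_cancel]
  rw [hf]
  exact (hc.integral_hasStrictDerivAt 0 t).hasDerivAt.const_add (f 0)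

theorem continuous_apply_of_span_dense {𝕜 X E F : Type*} [NontriviallyNormedField 𝕜]
    [TopologicalSpace X] [SeminormedAddCommGroup E] [NormedSpace 𝕜 E] [SeminormedAddCommGroup F]
    [NormedSpace 𝕜 F] {U : X → E →L[𝕜] F} {C : NNReal} (hU : ∀ t, ‖U t‖₊ ≤ C) {S : Set E}
    (hS : (Submodule.span 𝕜 S).topologicalClosure = ⊤)
    (h : ∀ x ∈ S, Continuous fun t => U t x) (x : E) : Continuous fun t => U t x := by
  have hequi : Equicontinuous fun t => (U t : E → F) :=
    (LipschitzWith.uniformEquicontinuous _ C fun t =>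
      (U t).lipschitz.weaken (hU t)).equicontinuous
  have hclosed : IsClosed {x | Continuous fun t => U t x} :=
    (UniformFun.isClosed_setOfPred_continuous (β := F) X).preimage
      (equicontinuous_iff_continuous.1 hequi)
  have hspan : ∀ x ∈ Submodule.span 𝕜 S, Continuous fun t => U t x := fun x hx => by
    induction hx using Submodule.span_induction with
    | mem x hx => exact h x hx
    | zero => simpa using continuous_const
    | add x y _ _ hx hy => simpa using hx.fun_add hy
    | smul a x _ hx => simpa using hx.fun_const_smul a
  refine closure_minimal (s := (Submodule.span 𝕜 S : Set E)) hspan hclosed ?_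
  rw [← Submodule.topologicalClosure_coe, hS]
  trivial

theorem span_range_lp_single_topologicalClosure :
    (Submodule.span ℂ (Set.range fun n => (lp.single 2 n 1 : SeqLp 2))).topologicalClosure = ⊤ := by
  let e : HilbertBasis ℕ ℂ (SeqLp 2) := .ofRepr (.refl ℂ (SeqLp 2))
  have he : (fun n => (lp.single 2 n 1 : SeqLp 2)) = e := funext e.repr_symm_single
  rw [he, e.dense_span]

theorem hasSum_mul_apply_lp_single (B : SeqLp 2 →L[ℂ] SeqLp 2) (u : SeqLp 2) (n : ℕ) :
    HasSum (fun k => u k * B (lp.single 2 k 1) n) (B u n) := by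
  have hsum := ((lp.hasSum_single ENNReal.ofNat_ne_top u).mapL B).mapL
    (lp.evalCLM ℂ (fun _ : ℕ => ℂ) 2 n)
  refine hsum.congr_fun fun k => ?_
  have hsingle : (lp.single 2 k (u k) : SeqLp 2) = u k • lp.single 2 k 1 := by
    rw [← lp.single_smul, smul_eq_mul, mul_one]
  rw [hsingle, map_smul]
  rfl

theorem norm_asOneInfty_le {B : SeqLp 2 →L[ℂ] SeqLp 2} {C : ℝ} (hC : 0 ≤ C)
    (h : ∀ n k, ‖B (lp.single 2 k 1) n‖ ≤ C) : ‖asOneInfty B‖ ≤ C := by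
  refine ContinuousLinearMap.opNorm_le_bound _ hC fun u =>
    lp.norm_le_of_forall_le (by positivity) fun n => ?_
  have hu : HasSum (fun k => ‖u k‖) ‖u‖ := by
    simpa using lp.hasSum_norm (p := 1) (by norm_num) u
  have hBu : asOneInfty B u n = ∑' k, u k * B (lp.single 2 k 1) n :=
    (hasSum_mul_apply_lp_single B (inclOneTwo u) n).tsum_eq.symm
  rw [hBu]
  refine tsum_of_norm_bounded (hu.mul_left C) fun k => ?_
  rw [norm_mul, mul_comm]
  exact mul_le_mul_of_nonneg_right (h n k) (norm_nonneg _)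

theorem norm_apply_lp_single_le_norm_asOneInfty (B : SeqLp 2 →L[ℂ] SeqLp 2) (n k : ℕ) :
    ‖B (lp.single 2 k 1) n‖ ≤ ‖asOneInfty B‖ := by
  have hop := (asOneInfty B).le_opNorm (lp.single 1 k 1)
  rw [lp.norm_single one_pos, norm_one, mul_one] at hop
  exact (lp.norm_apply_le_norm ENNReal.top_ne_zero (asOneInfty B (lp.single 1 k 1)) n).trans hop

/-- The `n`-th row, equivalently column, of the matrix of `exp(-itH₀)`. -/
noncomputable def laguerreRow (t : ℝ) (n : ℕ) : SeqLp 2 :=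
  ⟨laguerreKernel (laguerreParam t) n,
    (memℓp_gen (p := 1) (by
      simpa using summable_norm_laguerreKernel (norm_laguerreParam_sub_one_lt t) n)).of_exponent_ge
      one_le_two⟩

theorem inner_laguerreRow_left (t : ℝ) (n : ℕ) (u : SeqLp 2) :
    inner ℂ (laguerreRow t n) u = ∑' k, laguerreKernel (laguerreParam (-t)) n k * u k := by
  rw [lp.inner_eq_tsum]
  refine tsum_congr fun k => ?_
  rw [RCLike.inner_apply, mul_comm, ← conj_laguerreKernel_laguerreParam]
  rfl

theorem inner_laguerreRow_laguerreRow (s t : ℝ) (n m : ℕ) :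
    inner ℂ (laguerreRow s n) (laguerreRow t m) = laguerreKernel (laguerreParam (t - s)) n m := by
  rw [inner_laguerreRow_left, ← neg_add_eq_sub,
    ← tsum_laguerreKernel_mul_laguerreKernel_laguerreParam]
  rfl

theorem orthonormal_laguerreRow (t : ℝ) : Orthonormal ℂ (laguerreRow t) := by
  rw [orthonormal_iff_ite]
  intro n m
  rw [inner_laguerreRow_laguerreRow, sub_self, laguerreParam_zero, laguerreKernel_one]

theorem laguerreRow_zero (n : ℕ) : laguerreRow 0 n = lp.single 2 n 1 := by
  ext k
  have hk : laguerreRow 0 n k = laguerreKernel (laguerreParam 0) n k := rfl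
  simp [hk, laguerreParam_zero, laguerreKernel_one, Pi.single_apply, eq_comm]

theorem continuous_laguerreRow (n : ℕ) : Continuous fun t => laguerreRow t n := by
  have hdist : ∀ s t, dist (laguerreRow t n) (laguerreRow s n) =
      √(2 - 2 * (laguerreKernel (laguerreParam (s - t)) n n).re) := fun s t => by
    rw [dist_eq_norm, ← Real.sqrt_sq (norm_nonneg _), norm_sub_sq (𝕜 := ℂ),
      (orthonormal_laguerreRow t).1, (orthonormal_laguerreRow s).1, inner_laguerreRow_laguerreRow,
      RCLike.re_to_complex]
    ring_nf
  have hkernel : Continuous fun t => laguerreKernel (laguerreParam t) n n :=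
    continuous_iff_continuousAt.2 fun t =>
      (hasDerivAt_laguerreKernel_laguerreParam t n n).continuousAt
  refine continuous_iff_continuousAt.2 fun s => tendsto_iff_dist_tendsto_zero.2 ?_
  simp only [hdist]
  have hcont : Continuous fun t =>
      √(2 - 2 * (laguerreKernel (laguerreParam (s - t)) n n).re) := by
    have hshift := hkernel.comp (continuous_sub_left s)
    exact (continuous_const.sub (continuous_const.mul
      (Complex.continuous_re.comp hshift))).sqrt
  refine (hcont.tendsto s).trans_eq ?_
  simp [laguerreParam_zero, laguerreKernel_one]

theorem hasDerivAt_of_forall_hasDerivAt_apply {f c : ℝ → SeqLp 2} (hc : Continuous c)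
    (h : ∀ n t, HasDerivAt (fun t => f t n) (c t n) t) (t : ℝ) : HasDerivAt f (c t) t :=
  hasDerivAt_of_forall_hasDerivAt_comp
    (φ := fun n => (lp.evalCLM ℂ (fun _ : ℕ => ℂ) 2 n).restrictScalars ℝ)
    (fun _ _ hxy => lp.ext (funext hxy)) hc h t

theorem hasDerivAt_laguerreRow (t : ℝ) (n : ℕ) : HasDerivAt (fun t => laguerreRow t n)
    (-Complex.I • ((n : ℂ) • laguerreRow t (n - 1) + (2 * n + 1 : ℂ) • laguerreRow t n
      + (n + 1 : ℂ) • laguerreRow t (n + 1))) t := by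
  refine hasDerivAt_of_forall_hasDerivAt_apply (c := fun t => -Complex.I •
    ((n : ℂ) • laguerreRow t (n - 1) + (2 * n + 1 : ℂ) • laguerreRow t n
      + (n + 1 : ℂ) • laguerreRow t (n + 1))) ?_ (fun k t => ?_) t
  · have hrow := continuous_laguerreRow
    fun_prop
  · refine (hasDerivAt_laguerreKernel_laguerreParam t n k).congr_deriv ?_
    rw [laguerreTau_laguerreKernel]
    rfl

/-- The unitary group `t ↦ exp(-itH₀)`, defined by mapping the standard basis of `ℓ²(ℕ₀)` to the
orthonormal family `laguerreRow t`. -/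
noncomputable def laguerreGroup (t : ℝ) : SeqLp 2 →L[ℂ] SeqLp 2 :=
  (orthonormal_laguerreRow t).orthogonalFamily.linearIsometry.toContinuousLinearMap

theorem norm_laguerreGroup_apply (t : ℝ) (u : SeqLp 2) : ‖laguerreGroup t u‖ = ‖u‖ :=
  (orthonormal_laguerreRow t).orthogonalFamily.linearIsometry.norm_map u

theorem laguerreGroup_single (t : ℝ) (n : ℕ) :
    laguerreGroup t (lp.single 2 n 1) = laguerreRow t n := by
  refine ((orthonormal_laguerreRow t).orthogonalFamily.linearIsometry_apply_single 1).trans ?_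
  rw [LinearIsometry.toSpanSingleton_apply, one_smul]

theorem laguerreGroup_apply (t : ℝ) (u : SeqLp 2) (n : ℕ) :
    laguerreGroup t u n = ∑' k, laguerreKernel (laguerreParam t) n k * u k := by
  refine ((hasSum_mul_apply_lp_single (laguerreGroup t) u n).congr_fun fun k => ?_).tsum_eq.symm
  rw [laguerreGroup_single, mul_comm, laguerreKernel_comm]
  rfl

theorem laguerreGroup_apply_eq_inner (t : ℝ) (u : SeqLp 2) (n : ℕ) :
    laguerreGroup t u n = inner ℂ (laguerreRow (-t) n) u := by
  rw [inner_laguerreRow_left, neg_neg, laguerreGroup_apply]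

theorem laguerreGroup_zero : laguerreGroup 0 = 1 := by
  ext u n
  rw [laguerreGroup_apply_eq_inner, neg_zero, laguerreRow_zero, lp.inner_single_left]
  simp

theorem laguerreGroup_add (s t : ℝ) :
    laguerreGroup (s + t) = laguerreGroup s * laguerreGroup t := by
  refine ContinuousLinearMap.ext_on
    (Submodule.dense_iff_topologicalClosure_eq_top.2 span_range_lp_single_topologicalClosure) ?_
  rintro _ ⟨m, rfl⟩
  ext n
  rw [mul_apply_eq_comp, laguerreGroup_single, laguerreGroup_single, laguerreGroup_apply]
  refine (laguerreKernel_comm _ m n).trans ?_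
  rw [← tsum_laguerreKernel_mul_laguerreKernel_laguerreParam]
  rfl

theorem laguerreGroup_mem_unitary (t : ℝ) : laguerreGroup t ∈ unitary (SeqLp 2 →L[ℂ] SeqLp 2) := by
  have hleft : star (laguerreGroup t) * laguerreGroup t = 1 :=
    (ContinuousLinearMap.norm_map_iff_adjoint_comp_self _).1 (norm_laguerreGroup_apply t)
  have hright : laguerreGroup t * laguerreGroup (-t) = 1 := by
    rw [← laguerreGroup_add, add_neg_cancel, laguerreGroup_zero]
  refine Unitary.mem_iff.2 ⟨hleft, ?_⟩
  rw [left_inv_eq_right_inv hleft hright, hright]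

theorem continuous_laguerreGroup_apply (u : SeqLp 2) : Continuous fun t => laguerreGroup t u := by
  refine continuous_apply_of_span_dense (C := 1) (fun t => ?_)
    span_range_lp_single_topologicalClosure ?_ u
  · exact LinearIsometry.norm_toContinuousLinearMap_le _
  · rintro _ ⟨n, rfl⟩
    simpa only [laguerreGroup_single] using continuous_laguerreRow n

theorem hasDerivAt_laguerreGroup_apply_apply (u : SeqLp 2) (n : ℕ) (t : ℝ) :
    HasDerivAt (fun t => laguerreGroup t u n)
      (-Complex.I * laguerreTau (laguerreGroup t u) n) t := by
  have hrow : HasDerivAt (fun t => laguerreRow (-t) n) _ t :=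
    (hasDerivAt_laguerreRow (-t) n).scomp t (hasDerivAt_neg t)
  simp only [laguerreGroup_apply_eq_inner]
  refine (hrow.inner ℂ (hasDerivAt_const t u)).congr_deriv ?_
  rw [laguerreTau_apply]
  simp only [laguerreGroup_apply_eq_inner, inner_zero_right, zero_add, inner_smul_left,
    inner_add_left, neg_smul, one_smul, inner_neg_left, map_add, map_mul, map_one,
    Complex.conj_I, Complex.conj_natCast, Complex.conj_ofNat]
  ring

theorem laguerreTau_laguerreGroup (t : ℝ) (u : laguerreOperator.domain) :
    laguerreTau (laguerreGroup t u) = laguerreGroup t (laguerreOperator u) := by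
  funext n
  have hcoord : (laguerreGroup t u : ℕ → ℂ) = _ := funext (laguerreGroup_apply t u)
  rw [hcoord, laguerreGroup_apply]
  exact (tsum_laguerreKernel_mul_laguerreTau (norm_laguerreParam_sub_one_lt t) n
    (lp.norm_apply_le_norm two_ne_zero (u : SeqLp 2))).symm

theorem hasDerivAt_laguerreGroup_apply (u : laguerreOperator.domain) (t : ℝ) :
    HasDerivAt (fun t => laguerreGroup t u)
      (-Complex.I • laguerreGroup t (laguerreOperator u)) t := by
  refine hasDerivAt_of_forall_hasDerivAt_apply
    (c := fun t => -Complex.I • laguerreGroup t (laguerreOperator u))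
    ((continuous_laguerreGroup_apply _).fun_const_smul _) (fun n t => ?_) t
  refine (hasDerivAt_laguerreGroup_apply_apply u n t).congr_deriv ?_
  rw [laguerreTau_laguerreGroup]
  rfl

theorem exists_mem_domain_laguerreOperator {u f : SeqLp 2} (h : laguerreTau u = f) :
    ∃ hu : u ∈ laguerreOperator.domain, laguerreOperator ⟨u, hu⟩ = f :=
  ⟨show Memℓp (laguerreTau u) 2 from h ▸ lp.memℓp f, lp.ext h⟩

theorem isEvolutionGroup_laguerreGroup : IsEvolutionGroup laguerreOperator laguerreGroup where
  unitary := laguerreGroup_mem_unitary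
  map_zero := laguerreGroup_zero
  map_add := laguerreGroup_add
  continuous := continuous_laguerreGroup_apply
  generator u f := by
    have hzero : laguerreGroup 0 u = u := by rw [laguerreGroup_zero, one_apply_eq_self]
    have hiff := tendsto_I_div_smul_iff_hasDerivAt (fun t => laguerreGroup t u) f
    rw [hzero] at hiff
    rw [hiff]
    constructor
    · refine fun h => exists_mem_domain_laguerreOperator (funext fun n => ?_)
      have hcoord := ((lp.evalCLM ℂ (fun _ : ℕ => ℂ) 2 n).restrictScalars
        ℝ).hasFDerivAt.comp_hasDerivAt (0 : ℝ) h
      have hderiv := (hasDerivAt_laguerreGroup_apply_apply u n 0).unique hcoord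
      rw [hzero] at hderiv
      exact mul_left_cancel₀ (neg_ne_zero.2 Complex.I_ne_zero) hderiv
    · rintro ⟨hu, rfl⟩
      have hderiv := hasDerivAt_laguerreGroup_apply ⟨u, hu⟩ 0
      rwa [laguerreGroup_zero, one_apply_eq_self] at hderiv

theorem norm_asOneInfty_laguerreGroup (t : ℝ) :
    ‖asOneInfty (laguerreGroup t)‖ = 1 / √(1 + t ^ 2) := by
  have hentry : ∀ n k, laguerreGroup t (lp.single 2 k 1) n =
      laguerreKernel (laguerreParam t) k n := fun n k => by
    rw [laguerreGroup_single]
    rfl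
  rw [← norm_laguerreParam]
  apply le_antisymm
  · refine norm_asOneInfty_le (norm_nonneg _) fun n k => ?_
    rw [hentry]
    exact norm_laguerreKernel_le (normSq_laguerreParam t) k n
  · have h00 := norm_apply_lp_single_le_norm_asOneInfty (laguerreGroup t) 0 0
    rwa [hentry, laguerreKernel_zero_left, pow_zero, mul_one] at h00

theorem theorem1 :
    ∃ U : ℝ → SeqLp 2 →L[ℂ] SeqLp 2,
      IsEvolutionGroup laguerreOperator U ∧
      (∀ V : ℝ → SeqLp 2 →L[ℂ] SeqLp 2, IsEvolutionGroup laguerreOperator V → V = U) ∧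
      ∀ t : ℝ, ‖asOneInfty (U t)‖ = 1 / Real.sqrt (1 + t ^ 2) :=
  ⟨laguerreGroup, isEvolutionGroup_laguerreGroup,
    fun _ hV => hV.unique isEvolutionGroup_laguerreGroup, norm_asOneInfty_laguerreGroup⟩
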